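/- Let $\|v\|_T = |v_1| + |v_2|$ be the taxicab norm on $\mathbb{R}^2$. The taxicab Poincaré disk is the set $D_T = \{x \in \mathbb{R}^2 : \|x\|_T < 1\}$ in which a tangent vector $v$ based at $x \in D_T$ has norm $\|v\|_T/(1 - \|x\|_T^2)$. For $p, q \in D_T$ the distance $d(p,q)$ is the infimum of the lengths $$\operatorname{len}(\gamma) = \int_0^1 \frac{|\gamma_1'(t)| + |\gamma_2'(t)|}{1 - (|\gamma_1(t)| + |\gamma_2(t)|)^2}\, dt$$ over all curves $\gamma = (\gamma_1, \gamma_2) : [0,1] \to D_T$ with absolutely continuous components, $\gamma(0) = p$ and $\gamma(1) = q$. The isometry group of $D_T$ is the group, under composition, of all bijections $\Psi : D_T \to D_T$ with $d(\Psi(p), \Psi(q)) = d(p,q)$ for all $p, q \in D_T$. Theorem C. The isometry group of $D_T$ is isomorphic to the dihedral group $D_4$ of order $8$. It consists exactly of the rotations about the origin by integer multiples of $\pi/2$, the reflections in the two coordinate axes, and the reflections in the two lines through the origin of slope $\pm 1$. -/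

import Mathlib

namespace TaxicabPoincare

/-- The taxicab norm on the plane. -/
def taxicabNorm (v : ℝ × ℝ) : ℝ := |v.1| + |v.2|

/-- The underlying set of the taxicab Poincaré disk: the open unit ball of the taxicab norm. -/
def disk : Set (ℝ × ℝ) := {x | taxicabNorm x < 1}

/-- The norm of a tangent vector `v` based at the point `x` of the disk. -/
noncomputable def tangentNorm (x v : ℝ × ℝ) : ℝ := taxicabNorm v / (1 - taxicabNorm x ^ 2)

/-- The set of curves from `p` to `q`: curves in the disk parametrized by `[0, 1]`
whose two components are absolutely continuous. Only the values on `[0, 1]` matter. -/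
def curves (p q : disk) : Set (ℝ → ℝ × ℝ) :=
  {γ | AbsolutelyContinuousOnInterval (fun t => (γ t).1) 0 1 ∧
    AbsolutelyContinuousOnInterval (fun t => (γ t).2) 0 1 ∧
    (∀ t ∈ Set.Icc (0 : ℝ) 1, γ t ∈ disk) ∧ γ 0 = p ∧ γ 1 = q}

/-- The length of a curve: the integral over `[0, 1]` of the norm of its velocity,
which exists almost everywhere and is integrable for absolutely continuous curves. -/
noncomputable def len (γ : ℝ → ℝ × ℝ) : ℝ :=
  ∫ t in (0 : ℝ)..1, tangentNorm (γ t) (deriv (fun s => (γ s).1) t, deriv (fun s => (γ s).2) t)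

/-- The distance of the taxicab Poincaré disk: the infimum of the lengths of the curves
from `p` to `q`. -/
noncomputable def diskDist (p q : disk) : ℝ := sInf (len '' curves p q)

/-- The isometry group of the taxicab Poincaré disk: all bijections of the disk onto itself
that preserve the distance `diskDist`, under composition. -/
noncomputable def isometryGroup : Subgroup (Equiv.Perm disk) where
  carrier := {Ψ | ∀ p q, diskDist (Ψ p) (Ψ q) = diskDist p q}
  one_mem' := fun _ _ => rfl
  mul_mem' := by
    intro Ψ Φ hΨ hΦ p q
    exact (hΨ (Φ p) (Φ q)).trans (hΦ p q)
  inv_mem' := by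
    intro Ψ hΨ p q
    have h := hΨ (Ψ⁻¹ p) (Ψ⁻¹ q)
    have e : ∀ x, Ψ (Ψ⁻¹ x) = x := Ψ.apply_symm_apply
    rw [e, e] at h
    exact h.symm

/-- The counterclockwise rotation of the disk about the origin by `π / 2`. -/
def quarterTurn : Equiv.Perm disk where
  toFun p := ⟨(-p.1.2, p.1.1), by
    have h := p.2; simp only [disk, taxicabNorm, Set.mem_ofPred_eq, abs_neg] at h ⊢; linarith⟩
  invFun p := ⟨(p.1.2, -p.1.1), by
    have h := p.2; simp only [disk, taxicabNorm, Set.mem_ofPred_eq, abs_neg] at h ⊢; linarith⟩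
  left_inv p := by ext <;> simp
  right_inv p := by ext <;> simp

/-- The reflection of the disk in the first coordinate axis. -/
def reflAxis₁ : Equiv.Perm disk where
  toFun p := ⟨(p.1.1, -p.1.2), by
    have h := p.2; simp only [disk, taxicabNorm, Set.mem_ofPred_eq, abs_neg] at h ⊢; linarith⟩
  invFun p := ⟨(p.1.1, -p.1.2), by
    have h := p.2; simp only [disk, taxicabNorm, Set.mem_ofPred_eq, abs_neg] at h ⊢; linarith⟩
  left_inv p := by ext <;> simp
  right_inv p := by ext <;> simp

/-- The reflection of the disk in the second coordinate axis. -/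
def reflAxis₂ : Equiv.Perm disk where
  toFun p := ⟨(-p.1.1, p.1.2), by
    have h := p.2; simp only [disk, taxicabNorm, Set.mem_ofPred_eq, abs_neg] at h ⊢; linarith⟩
  invFun p := ⟨(-p.1.1, p.1.2), by
    have h := p.2; simp only [disk, taxicabNorm, Set.mem_ofPred_eq, abs_neg] at h ⊢; linarith⟩
  left_inv p := by ext <;> simp
  right_inv p := by ext <;> simp

/-- The reflection of the disk in the line through the origin of slope `1`. -/
def reflDiag : Equiv.Perm disk where
  toFun p := ⟨(p.1.2, p.1.1), by
    have h := p.2; simp only [disk, taxicabNorm, Set.mem_ofPred_eq] at h ⊢; linarith⟩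
  invFun p := ⟨(p.1.2, p.1.1), by
    have h := p.2; simp only [disk, taxicabNorm, Set.mem_ofPred_eq] at h ⊢; linarith⟩
  left_inv p := by ext <;> simp
  right_inv p := by ext <;> simp

/-- The reflection of the disk in the line through the origin of slope `-1`. -/
def reflAntidiag : Equiv.Perm disk where
  toFun p := ⟨(-p.1.2, -p.1.1), by
    have h := p.2; simp only [disk, taxicabNorm, Set.mem_ofPred_eq, abs_neg] at h ⊢; linarith⟩
  invFun p := ⟨(-p.1.2, -p.1.1), by
    have h := p.2; simp only [disk, taxicabNorm, Set.mem_ofPred_eq, abs_neg] at h ⊢; linarith⟩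
  left_inv p := by ext <;> simp
  right_inv p := by ext <;> simp

end TaxicabPoincare

/-!
The distance of the taxicab Poincaré disk has a closed form. Write `‖·‖` for the taxicab norm and
`overlap p q = (‖p‖ + ‖q‖ - ‖p - q‖) / 2`, the norm of the coordinatewise median of `0`, `p`, `q`.
Then `diskDist p q = artanh ‖p‖ + artanh ‖q‖ - 2 * artanh (overlap p q)` (`diskDist_eq`). The
upper bound is the length of the path that runs straight from `p` to the median and on to `q`. For
the lower bound, convexity of `artanh` shows that the right-hand side, as a function of `q`, grows
along a curve at most at the speed of the curve (`abs_overlapDist_sub_le`), and the fundamental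
theorem of calculus for absolutely continuous functions applies.

By strict convexity of `artanh`, a point `z` between `p` and `q` in this metric lies between `0` and
`p`, or between `0` and `q`, in the taxicab sense (`Between.overlap_eq_or`). It follows that a point
that lies between any two of four other points must be on a coordinate axis (`IsCross`), and
that the origin is the only point between any two of three others that are of this kind
(`IsCenter`). These are metric properties, so an isometry fixes the origin. Since
`diskDist 0 p = artanh ‖p‖`, it then preserves the norm and the overlap.

Consequently an isometry permutes the four points at norm `1 / 2` on the axes. A point of the disk is
determined by its norm and its overlaps with these four points, so an isometry is determined by this
permutation, and the points `(± 1 / 4, 1 / 4)` show that neighbours among the four go to neighbours.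
This leaves the powers of the quarter turn and their products with one reflection
(`isometry_classification`), which form the faithful image of the dihedral group.
-/

/-! ### Convexity of the inverse hyperbolic tangent -/

namespace Real

theorem hasDerivAt_artanh {s : ℝ} (hs : s ∈ Set.Ioo (-1 : ℝ) 1) :
    HasDerivAt artanh (1 - s ^ 2)⁻¹ s := by
  obtain ⟨h1, h2⟩ := hs
  have hd : HasDerivAt (fun x => 1 / 2 * (log (1 + x) - log (1 - x))) (1 - s ^ 2)⁻¹ s := by
    have e1 : HasDerivAt (fun x : ℝ => log (1 + x)) (1 / (1 + s)) s :=
      ((hasDerivAt_id s).const_add 1).log (by simp only [id]; linarith)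
    have e2 : HasDerivAt (fun x : ℝ => log (1 - x)) (-1 / (1 - s)) s :=
      ((hasDerivAt_id s).const_sub 1).log (by simp only [id]; linarith)
    refine ((e1.sub e2).const_mul (1 / 2)).congr_deriv ?_
    have : 1 + s ≠ 0 := by linarith
    have : 1 - s ≠ 0 := by linarith
    have : 1 - s ^ 2 ≠ 0 := by nlinarith
    field_simp
    ring
  refine hd.congr_of_eventuallyEq ?_
  filter_upwards [Ioo_mem_nhds h1 h2] with x hx
  rw [artanh_eq_half_log ⟨hx.1.le, hx.2.le⟩, log_div (by linarith [hx.1]) (by linarith [hx.2])]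

end Real

namespace TaxicabPoincare

open Real Set Filter Topology MeasureTheory

theorem inv_one_sub_sq_mono {s t : ℝ} (hs : 0 ≤ s) (hst : s ≤ t) (ht : t < 1) :
    (1 - s ^ 2)⁻¹ ≤ (1 - t ^ 2)⁻¹ :=
  inv_anti₀ (by nlinarith) (by nlinarith)

theorem inv_one_sub_sq_nonneg {s : ℝ} (hs : 0 ≤ s) (hs1 : s < 1) : 0 ≤ (1 - s ^ 2)⁻¹ :=
  inv_nonneg.2 (by nlinarith)

/-- The secant slope of `artanh` over `[s, t]` lies strictly between its derivatives at the ends. -/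
theorem artanh_secant_lt {s t : ℝ} (hs : 0 ≤ s) (hst : s < t) (ht : t < 1) :
    (1 - s ^ 2)⁻¹ * (t - s) < artanh t - artanh s ∧
      artanh t - artanh s < (1 - t ^ 2)⁻¹ * (t - s) := by
  have hder : ∀ x ∈ Set.Icc s t, HasDerivAt artanh (1 - x ^ 2)⁻¹ x := fun x hx =>
    hasDerivAt_artanh ⟨by linarith [hx.1], by linarith [hx.2]⟩
  obtain ⟨c, ⟨hsc, hct⟩, hc⟩ := exists_hasDerivAt_eq_slope artanh (fun x => (1 - x ^ 2)⁻¹) hst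
    (fun x hx => (hder x hx).continuousAt.continuousWithinAt)
    (fun x hx => hder x ⟨hx.1.le, hx.2.le⟩)
  have e : artanh t - artanh s = (1 - c ^ 2)⁻¹ * (t - s) := by
    rw [hc, div_mul_cancel₀ _ (by linarith)]
  rw [e]
  constructor
  · exact mul_lt_mul_of_pos_right (inv_strictAnti₀ (by nlinarith) (by nlinarith)) (by linarith)
  · exact mul_lt_mul_of_pos_right (inv_strictAnti₀ (by nlinarith) (by nlinarith)) (by linarith)

theorem artanh_secant_le {s t : ℝ} (hs : 0 ≤ s) (hst : s ≤ t) (ht : t < 1) :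
    (1 - s ^ 2)⁻¹ * (t - s) ≤ artanh t - artanh s ∧
      artanh t - artanh s ≤ (1 - t ^ 2)⁻¹ * (t - s) := by
  rcases hst.eq_or_lt with rfl | h
  · simp
  · exact ⟨(artanh_secant_lt hs h ht).1.le, (artanh_secant_lt hs h ht).2.le⟩

/-- Strict convexity of `artanh`: if `u` and `v` lie below `z`, and `artanh z + artanh m` equals
`artanh u + artanh v` although `z + m` is at least `u + v`, then one of `u`, `v` is `z`. -/
theorem eq_or_eq_of_artanh_add_eq {z m u v : ℝ} (hm : 0 ≤ m) (hu : 0 ≤ u) (hv : 0 ≤ v) (hz : z < 1)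
    (huz : u ≤ z) (hvz : v ≤ z) (hm1 : m < 1) (hsum : u + v ≤ z + m)
    (h : artanh z + artanh m = artanh u + artanh v) : u = z ∨ v = z := by
  wlog huv : u ≤ v generalizing u v
  · exact (this hv hu hvz huz (by linarith) (by linarith) (by linarith)).symm
  by_contra! hne
  have hvz' : v < z := lt_of_le_of_ne hvz hne.2
  have h1 := (artanh_secant_lt hv hvz' hz).1
  have hmu : m < u := by
    rw [← artanh_lt_artanh_iff ⟨by linarith, hm1⟩ ⟨by linarith, by linarith⟩]
    have := artanh_lt_artanh (by linarith) hz hvz'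
    linarith
  have h2 := (artanh_secant_lt hm hmu (by linarith)).2
  have h3 := inv_one_sub_sq_mono hu huv (by linarith)
  have h4 := inv_one_sub_sq_nonneg hv (by linarith)
  have h5 := mul_le_mul_of_nonneg_right h3 (by linarith : 0 ≤ u - m)
  have h6 := mul_le_mul_of_nonneg_left (by linarith : u - m ≤ z - v) h4
  linarith

/-- The scalar inequality behind the local Lipschitz bound for `overlapDist`: `x`, `y` stand for
the norms of two points, `g`, `h` for their overlaps with a third point, and `D` for their
taxicab distance. -/
theorem abs_artanh_sub_sub_le {x y g h D : ℝ} (hh : 0 ≤ h) (hg : 0 ≤ g) (hhy : h ≤ y) (hgx : g ≤ x)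
    (hyx : y ≤ x) (hx : x < 1) (hD : x - y ≤ D) (hD' : |x - y - 2 * (g - h)| ≤ D) :
    |(artanh x - artanh y) - 2 * (artanh g - artanh h)| ≤ (1 - x ^ 2)⁻¹ * D := by
  rw [abs_le] at hD'
  have hxy := artanh_secant_le (by linarith) hyx hx
  have hx0 := inv_one_sub_sq_nonneg (by linarith) hx
  have hD0 : 0 ≤ D := by linarith
  have hy0 := inv_one_sub_sq_nonneg (by linarith : 0 ≤ y) (by linarith)
  have hxy0 : 0 ≤ artanh x - artanh y := (mul_nonneg hy0 (by linarith)).trans hxy.1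
  have hxD := mul_le_mul_of_nonneg_left hD hx0
  rw [abs_le]
  rcases le_total g h with hgh | hhg
  · have hgh' := artanh_secant_le hg hgh (by linarith)
    have hg0 := inv_one_sub_sq_nonneg hg (by linarith)
    have h0 := mul_nonneg hg0 (by linarith : 0 ≤ h - g)
    have h1 := mul_le_mul_of_nonneg_right
      (inv_one_sub_sq_mono hh (hhy.trans hyx) hx) (by linarith : 0 ≤ h - g)
    have h2 := mul_le_mul_of_nonneg_left (by linarith : x - y + 2 * (h - g) ≤ D) hx0
    have h3 := mul_nonneg hx0 hD0
    constructor <;> linarith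
  · have hh0 := inv_one_sub_sq_nonneg hh (by linarith)
    have hg0 := inv_one_sub_sq_nonneg hg (by linarith)
    have hgh' := artanh_secant_le hh hhg (by linarith)
    have h0 := mul_nonneg hh0 (by linarith : 0 ≤ g - h)
    have hgD := mul_le_mul_of_nonneg_right (inv_one_sub_sq_mono hg hgx hx) hD0
    have h2 := mul_le_mul_of_nonneg_left (by linarith : 2 * (g - h) - (x - y) ≤ D) hg0
    refine ⟨?_, by linarith⟩
    rcases le_total g y with hgy | hyg
    · have h1 := mul_le_mul_of_nonneg_right (inv_one_sub_sq_mono hg hgy (by linarith))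
        (by linarith : 0 ≤ x - y)
      linarith
    · have k1 := artanh_secant_le hh hhy (by linarith)
      have k2 := artanh_secant_le (by linarith) hyg (by linarith)
      have k3 := artanh_secant_le hg hgx hx
      have k4 := mul_le_mul_of_nonneg_right (inv_one_sub_sq_mono (by linarith) hyg (by linarith))
        (by linarith : 0 ≤ y - h)
      linarith

/-! ### Overlap of two points -/

theorem taxicabNorm_nonneg (v : ℝ × ℝ) : 0 ≤ taxicabNorm v := by
  unfold taxicabNorm; positivity

theorem taxicabNorm_add_le (v w : ℝ × ℝ) : taxicabNorm (v + w) ≤ taxicabNorm v + taxicabNorm w := by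
  simp only [taxicabNorm, Prod.fst_add, Prod.snd_add]
  linarith [abs_add_le v.1 w.1, abs_add_le v.2 w.2]

theorem taxicabNorm_sub_comm (v w : ℝ × ℝ) : taxicabNorm (v - w) = taxicabNorm (w - v) := by
  simp only [taxicabNorm, Prod.fst_sub, Prod.snd_sub, abs_sub_comm]

theorem taxicabNorm_sub_le (u v w : ℝ × ℝ) :
    taxicabNorm (u - w) ≤ taxicabNorm (u - v) + taxicabNorm (v - w) := by
  simpa using taxicabNorm_add_le (u - v) (v - w)

theorem taxicabNorm_le_add_sub (v w : ℝ × ℝ) :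
    taxicabNorm v ≤ taxicabNorm w + taxicabNorm (v - w) := by
  simpa using taxicabNorm_add_le w (v - w)

theorem continuous_taxicabNorm : Continuous taxicabNorm := by
  unfold taxicabNorm; fun_prop

/-- The Gromov product of `p` and `q` at the origin for the taxicab norm. It is the taxicab norm
of the median of `0`, `p` and `q`, that is, the length of the part that monotone paths from the
origin to `p` and to `q` can have in common. -/
noncomputable def overlap (p q : ℝ × ℝ) : ℝ :=
  (taxicabNorm p + taxicabNorm q - taxicabNorm (p - q)) / 2

theorem overlap_nonneg (p q : ℝ × ℝ) : 0 ≤ overlap p q := by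
  have := taxicabNorm_sub_le p 0 q
  have h := taxicabNorm_sub_comm 0 q
  simp only [sub_zero] at this h
  unfold overlap; linarith

theorem overlap_comm (p q : ℝ × ℝ) : overlap p q = overlap q p := by
  unfold overlap; rw [taxicabNorm_sub_comm]; ring

theorem overlap_le_left (p q : ℝ × ℝ) : overlap p q ≤ taxicabNorm p := by
  have := taxicabNorm_le_add_sub q p
  rw [taxicabNorm_sub_comm] at this
  unfold overlap; linarith

theorem overlap_le_right (p q : ℝ × ℝ) : overlap p q ≤ taxicabNorm q :=
  overlap_comm p q ▸ overlap_le_left q p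

theorem overlap_self (p : ℝ × ℝ) : overlap p p = taxicabNorm p := by
  simp [overlap, taxicabNorm]

/-- The closed form of the distance of the taxicab Poincaré disk. -/
noncomputable def overlapDist (p q : ℝ × ℝ) : ℝ :=
  artanh (taxicabNorm p) + artanh (taxicabNorm q) - 2 * artanh (overlap p q)

/-! ### Curves are at least as long as the closed form -/

theorem abs_overlapDist_sub_le (p : ℝ × ℝ) {x y : ℝ × ℝ} (hx : x ∈ disk) (hy : y ∈ disk) :
    |overlapDist p x - overlapDist p y| ≤
      (1 - max (taxicabNorm x) (taxicabNorm y) ^ 2)⁻¹ * taxicabNorm (x - y) := by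
  wlog hyx : taxicabNorm y ≤ taxicabNorm x generalizing x y
  · rw [abs_sub_comm, max_comm, taxicabNorm_sub_comm]
    exact this hy hx (le_of_not_ge hyx)
  rw [max_eq_left hyx]
  have h1 := taxicabNorm_sub_le p y x
  have h2 := taxicabNorm_sub_le p x y
  have h3 := taxicabNorm_sub_comm x y
  have key := abs_artanh_sub_sub_le (overlap_nonneg p y) (overlap_nonneg p x)
    (overlap_le_right p y) (overlap_le_right p x) hyx hx (D := taxicabNorm (x - y))
    (by linarith [taxicabNorm_le_add_sub x y])
    (by unfold overlap; rw [abs_le]; constructor <;> linarith)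
  convert key using 2
  unfold overlapDist; ring

/-- A function whose increments are dominated by those of two absolutely continuous functions
is absolutely continuous. -/
theorem absolutelyContinuousOnInterval_of_dist_le {X Y Z : Type*} [PseudoMetricSpace X]
    [PseudoMetricSpace Y] [PseudoMetricSpace Z] {f : ℝ → X} {g : ℝ → Y} {h : ℝ → Z} {a b C : ℝ}
    (hg : AbsolutelyContinuousOnInterval g a b) (hh : AbsolutelyContinuousOnInterval h a b)
    (hf : ∀ s ∈ uIcc a b, ∀ t ∈ uIcc a b,
      dist (f s) (f t) ≤ C * (dist (g s) (g t) + dist (h s) (h t))) :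
    AbsolutelyContinuousOnInterval f a b := by
  have lim := (Tendsto.add hg hh).const_mul C
  rw [add_zero, mul_zero] at lim
  refine squeeze_zero' (Eventually.of_forall fun E => Finset.sum_nonneg fun _ _ => dist_nonneg)
    ?_ lim
  rw [eventually_inf_principal]
  refine Eventually.of_forall fun E hE => ?_
  rw [← Finset.sum_add_distrib, Finset.mul_sum]
  exact Finset.sum_le_sum fun i hi => hf _ (hE.1 i hi).1 _ (hE.1 i hi).2

/-- Along a curve, the closed form of the distance to `p` grows at most at the speed of the
curve, wherever all derivatives exist. -/
theorem deriv_overlapDist_le {p : ℝ × ℝ} {γ : ℝ → ℝ × ℝ} {t : ℝ}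
    (hγ : ∀ᶠ s in 𝓝 t, γ s ∈ disk)
    (h1 : DifferentiableAt ℝ (fun s => (γ s).1) t) (h2 : DifferentiableAt ℝ (fun s => (γ s).2) t)
    (hf : DifferentiableAt ℝ (fun s => overlapDist p (γ s)) t) :
    deriv (fun s => overlapDist p (γ s)) t ≤
      tangentNorm (γ t) (deriv (fun s => (γ s).1) t, deriv (fun s => (γ s).2) t) := by
  have hcont : ContinuousAt (fun s => taxicabNorm (γ s)) t :=
    continuous_taxicabNorm.continuousAt.comp (h1.continuousAt.prodMk h2.continuousAt)
  have ht : taxicabNorm (γ t) < 1 := hγ.self_of_nhds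
  have lf := hf.hasDerivAt.hasDerivWithinAt (s := Ioi t)
  have l1 := h1.hasDerivAt.hasDerivWithinAt (s := Ioi t)
  have l2 := h2.hasDerivAt.hasDerivWithinAt (s := Ioi t)
  rw [hasDerivWithinAt_iff_tendsto_slope' self_notMem_Ioi] at lf l1 l2
  have lc : Tendsto (fun s => (1 - max (taxicabNorm (γ s)) (taxicabNorm (γ t)) ^ 2)⁻¹)
      (𝓝[>] t) (𝓝 (1 - taxicabNorm (γ t) ^ 2)⁻¹) := by
    have : Tendsto (fun s => max (taxicabNorm (γ s)) (taxicabNorm (γ t))) (𝓝[>] t)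
        (𝓝 (taxicabNorm (γ t))) := by
      simpa using (hcont.tendsto.mono_left nhdsWithin_le_nhds).max
        (tendsto_const_nhds (x := taxicabNorm (γ t)))
    exact ((this.pow 2).const_sub 1).inv₀ (by nlinarith [taxicabNorm_nonneg (γ t)])
  have lim := lc.mul (l1.abs.add l2.abs)
  have e : tangentNorm (γ t) (deriv (fun s => (γ s).1) t, deriv (fun s => (γ s).2) t) =
      (1 - taxicabNorm (γ t) ^ 2)⁻¹ *
        (|deriv (fun s => (γ s).1) t| + |deriv (fun s => (γ s).2) t|) := by
    rw [tangentNorm, div_eq_inv_mul]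
    rfl
  rw [e]
  refine le_of_tendsto_of_tendsto lf lim ?_
  filter_upwards [hγ.filter_mono nhdsWithin_le_nhds, self_mem_nhdsWithin] with s hs hts
  have hst : 0 < (s - t)⁻¹ := inv_pos.2 (sub_pos.2 hts)
  have k := (le_abs_self _).trans (abs_overlapDist_sub_le p hs hγ.self_of_nhds)
  have k' := mul_le_mul_of_nonneg_left k hst.le
  simp only [slope, vsub_eq_sub, smul_eq_mul, abs_mul, abs_of_pos hst]
  refine k'.trans_eq ?_
  simp only [taxicabNorm, Prod.fst_sub, Prod.snd_sub]
  ring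

theorem exists_taxicabNorm_le_of_mem_curves {p q : disk} {γ : ℝ → ℝ × ℝ} (hγ : γ ∈ curves p q) :
    ContinuousOn (fun t => taxicabNorm (γ t)) (Icc 0 1) ∧
      ∃ R < 1, ∀ t ∈ Icc (0 : ℝ) 1, taxicabNorm (γ t) ≤ R := by
  obtain ⟨h1, h2, hd, -, -⟩ := hγ
  have c1 := h1.continuousOn
  have c2 := h2.continuousOn
  rw [uIcc_of_le zero_le_one] at c1 c2
  have hc : ContinuousOn (fun t => taxicabNorm (γ t)) (Icc 0 1) :=
    continuous_taxicabNorm.comp_continuousOn (c1.prodMk c2)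
  obtain ⟨t, ht, hmax⟩ := isCompact_Icc.exists_isMaxOn (nonempty_Icc.2 zero_le_one) hc
  exact ⟨hc, _, hd t ht, fun s hs => hmax hs⟩

theorem intervalIntegrable_tangentNorm {p q : disk} {γ : ℝ → ℝ × ℝ} (hγ : γ ∈ curves p q) :
    IntervalIntegrable (fun t => tangentNorm (γ t)
      (deriv (fun s => (γ s).1) t, deriv (fun s => (γ s).2) t)) volume 0 1 := by
  have hc := (exists_taxicabNorm_le_of_mem_curves hγ).1
  obtain ⟨h1, h2, hd, -, -⟩ := hγ
  refine (h1.intervalIntegrable_deriv.abs.add h2.intervalIntegrable_deriv.abs).mul_continuousOn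
    (g := fun t => (1 - taxicabNorm (γ t) ^ 2)⁻¹) ?_
  rw [uIcc_of_le zero_le_one]
  refine (continuousOn_const.sub (hc.pow 2)).inv₀ fun t ht => ?_
  have : taxicabNorm (γ t) < 1 := hd t ht
  change 1 - taxicabNorm (γ t) ^ 2 ≠ 0
  nlinarith [taxicabNorm_nonneg (γ t)]

theorem overlapDist_le_len {p q : disk} {γ : ℝ → ℝ × ℝ} (hγ : γ ∈ curves p q) :
    overlapDist p q ≤ len γ := by
  obtain ⟨-, R, hR1, hR⟩ := exists_taxicabNorm_le_of_mem_curves hγ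
  have hint := intervalIntegrable_tangentNorm hγ
  obtain ⟨h1, h2, hd, h0, h1'⟩ := hγ
  have hac : AbsolutelyContinuousOnInterval (fun t => overlapDist p (γ t)) 0 1 := by
    refine absolutelyContinuousOnInterval_of_dist_le (C := (1 - R ^ 2)⁻¹) h1 h2 ?_
    rw [uIcc_of_le zero_le_one]
    intro s hs t ht
    refine (abs_overlapDist_sub_le p (hd s hs) (hd t ht)).trans ?_
    exact mul_le_mul_of_nonneg_right
      (inv_one_sub_sq_mono (le_max_of_le_left (taxicabNorm_nonneg _))
        (max_le (hR s hs) (hR t ht)) hR1) (taxicabNorm_nonneg _)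
  have e : overlapDist p q = ∫ t in (0 : ℝ)..1, deriv (fun s => overlapDist p (γ s)) t := by
    rw [hac.integral_deriv_eq_sub, h0, h1']
    simp only [overlapDist, overlap_self]
    ring
  rw [e]
  refine intervalIntegral.integral_mono_ae_restrict zero_le_one hac.intervalIntegrable_deriv hint ?_
  rw [← restrict_Ioo_eq_restrict_Icc]
  refine (ae_restrict_iff' measurableSet_Ioo).2 ?_
  filter_upwards [h1.ae_differentiableAt, h2.ae_differentiableAt, hac.ae_differentiableAt]
    with t d1 d2 df ht
  have ht' : t ∈ uIcc (0 : ℝ) 1 := by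
    rw [uIcc_of_le zero_le_one]; exact Ioo_subset_Icc_self ht
  refine deriv_overlapDist_le ?_ (d1 ht') (d2 ht') (df ht')
  filter_upwards [Ioo_mem_nhds ht.1 ht.2] with s hs
  exact hd s (Ioo_subset_Icc_self hs)

/-! ### A curve realizing the closed form -/

theorem exists_median (x y : ℝ) :
    ∃ m : ℝ, |x| = |m| + |x - m| ∧ |y| = |m| + |y - m| ∧ |x - y| = |x - m| + |y - m| := by
  rcases le_total 0 x with hx | hx <;> rcases le_total 0 y with hy | hy
  · rcases le_total x y with h | h
    · exact ⟨x, by simp, by grind, by grind⟩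
    · exact ⟨y, by grind, by simp, by simp⟩
  · exact ⟨0, by simp, by simp, by grind⟩
  · exact ⟨0, by simp, by simp, by grind⟩
  · rcases le_total x y with h | h
    · exact ⟨y, by grind, by simp, by simp⟩
    · exact ⟨x, by simp, by grind, by grind⟩

/-- The median of `0`, `p` and `q`: it lies between any two of them in the taxicab norm. -/
theorem exists_taxicab_median (p q : ℝ × ℝ) :
    ∃ m : ℝ × ℝ, taxicabNorm p = taxicabNorm m + taxicabNorm (p - m) ∧
      taxicabNorm q = taxicabNorm m + taxicabNorm (q - m) ∧ overlap p q = taxicabNorm m := by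
  obtain ⟨a, a1, a2, a3⟩ := exists_median p.1 q.1
  obtain ⟨b, b1, b2, b3⟩ := exists_median p.2 q.2
  refine ⟨(a, b), ?_, ?_, ?_⟩ <;> simp only [overlap, taxicabNorm, Prod.fst_sub, Prod.snd_sub] <;>
    linarith

theorem taxicabNorm_smul (s : ℝ) (v : ℝ × ℝ) : taxicabNorm (s • v) = |s| * taxicabNorm v := by
  simp only [taxicabNorm, Prod.smul_fst, Prod.smul_snd, smul_eq_mul, abs_mul]
  ring

/-- If `m` lies between `0` and `p`, the norm is affine on the segment from `m` to `p`. -/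
theorem taxicabNorm_add_smul {m p : ℝ × ℝ}
    (h : taxicabNorm p = taxicabNorm m + taxicabNorm (p - m)) {s : ℝ} (hs : s ∈ Icc (0 : ℝ) 1) :
    taxicabNorm (m + s • (p - m)) = taxicabNorm m + s * taxicabNorm (p - m) := by
  have h1 := taxicabNorm_add_le m (s • (p - m))
  have h2 := taxicabNorm_add_le (m + s • (p - m)) ((1 - s) • (p - m))
  have e : m + s • (p - m) + (1 - s) • (p - m) = p := by module
  rw [e, taxicabNorm_smul, abs_of_nonneg (by linarith [hs.2])] at h2
  rw [taxicabNorm_smul, abs_of_nonneg hs.1] at h1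
  linarith

/-- The piecewise affine path on `[0, 1]` from `x` to `m` to `y`, reaching `m` at time `1 / 2`. -/
noncomputable def bentPath (x m y t : ℝ) : ℝ :=
  m + max (1 - 2 * t) 0 * (x - m) + max (2 * t - 1) 0 * (y - m)

theorem bentPath_of_le (x m y : ℝ) {t : ℝ} (ht : t ≤ 1 / 2) :
    bentPath x m y t = m + (1 - 2 * t) * (x - m) := by
  rw [bentPath, max_eq_left (by linarith), max_eq_right (by linarith)]; ring

theorem bentPath_of_ge (x m y : ℝ) {t : ℝ} (ht : 1 / 2 ≤ t) :
    bentPath x m y t = m + (2 * t - 1) * (y - m) := by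
  rw [bentPath, max_eq_right (by linarith), max_eq_left (by linarith)]; ring

theorem deriv_bentPath_of_lt (x m y : ℝ) {t : ℝ} (ht : t < 1 / 2) :
    deriv (fun s => bentPath x m y s) t = -2 * (x - m) := by
  have h : (fun s => bentPath x m y s) =ᶠ[𝓝 t] fun s => m + (1 - 2 * s) * (x - m) := by
    filter_upwards [Iio_mem_nhds ht] with s hs using bentPath_of_le x m y (le_of_lt hs)
  rw [h.deriv_eq]
  have := ((((hasDerivAt_id t).const_mul 2).const_sub 1).mul_const (x - m)).const_add m
  exact this.deriv.trans (by ring)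

theorem deriv_bentPath_of_gt (x m y : ℝ) {t : ℝ} (ht : 1 / 2 < t) :
    deriv (fun s => bentPath x m y s) t = 2 * (y - m) := by
  have h : (fun s => bentPath x m y s) =ᶠ[𝓝 t] fun s => m + (2 * s - 1) * (y - m) := by
    filter_upwards [Ioi_mem_nhds ht] with s hs using bentPath_of_ge x m y (le_of_lt hs)
  rw [h.deriv_eq]
  have := ((((hasDerivAt_id t).const_mul 2).sub_const 1).mul_const (y - m)).const_add m
  exact this.deriv.trans (by ring)

theorem absolutelyContinuousOnInterval_bentPath (x m y a b : ℝ) :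
    AbsolutelyContinuousOnInterval (fun s => bentPath x m y s) a b := by
  have h1 : AbsolutelyContinuousOnInterval (fun s : ℝ => max (1 - 2 * s) 0) a b := by
    refine (LipschitzWith.of_dist_le_mul (K := 2) fun s t => ?_).lipschitzOnWith
      |>.absolutelyContinuousOnInterval
    rw [Real.dist_eq, Real.dist_eq]
    refine (abs_max_sub_max_le_abs _ _ _).trans_eq ?_
    rw [show 1 - 2 * s - (1 - 2 * t) = -(2 * (s - t)) by ring, abs_neg, abs_mul]
    simp
  have h2 : AbsolutelyContinuousOnInterval (fun s : ℝ => max (2 * s - 1) 0) a b := by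
    refine (LipschitzWith.of_dist_le_mul (K := 2) fun s t => ?_).lipschitzOnWith
      |>.absolutelyContinuousOnInterval
    rw [Real.dist_eq, Real.dist_eq]
    refine (abs_max_sub_max_le_abs _ _ _).trans_eq ?_
    rw [show 2 * s - 1 - (2 * t - 1) = 2 * (s - t) by ring, abs_mul]
    simp
  have h0 : AbsolutelyContinuousOnInterval (fun _ : ℝ => m) a b :=
    (LipschitzWith.const m).lipschitzOnWith.absolutelyContinuousOnInterval
  have e : (fun s => bentPath x m y s) = (fun _ => m) + (fun s => (x - m) * max (1 - 2 * s) 0) +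
      fun s => (y - m) * max (2 * s - 1) 0 := by
    funext s
    simp only [bentPath, Pi.add_apply]
    ring
  rw [e]
  exact (h0.add (h1.const_mul (x - m))).add (h2.const_mul (y - m))

/-- The length of a piece of curve along which the norm is affine and the speed is `ε` times the
radial speed; `ε` is `1` or `-1` in the applications. -/
theorem integral_tangentNorm_eq {γ : ℝ → ℝ × ℝ} {a b α β ε : ℝ} (hab : a ≤ b)
    (hγ : ∀ t ∈ Icc a b, γ t ∈ disk) (hN : ∀ t ∈ Icc a b, taxicabNorm (γ t) = α + β * t)
    (hd : ∀ t ∈ Ioo a b,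
      taxicabNorm (deriv (fun s => (γ s).1) t, deriv (fun s => (γ s).2) t) = ε * β)
    (hint : IntervalIntegrable (fun t => tangentNorm (γ t)
      (deriv (fun s => (γ s).1) t, deriv (fun s => (γ s).2) t)) volume a b) :
    ∫ t in a..b, tangentNorm (γ t) (deriv (fun s => (γ s).1) t, deriv (fun s => (γ s).2) t) =
      ε * (artanh (taxicabNorm (γ b)) - artanh (taxicabNorm (γ a))) := by
  have hder : ∀ t ∈ Icc a b, HasDerivAt (fun s => ε * artanh (α + β * s))
      (ε * ((1 - (α + β * t) ^ 2)⁻¹ * β)) t := by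
    intro t ht
    have hlt : taxicabNorm (γ t) < 1 := hγ t ht
    have h0 := taxicabNorm_nonneg (γ t)
    rw [hN t ht] at hlt h0
    have h1 : HasDerivAt (fun s => α + β * s) β t :=
      (((hasDerivAt_id t).const_mul β).const_add α).congr_deriv (mul_one β)
    exact (HasDerivAt.comp t (hasDerivAt_artanh ⟨by linarith, hlt⟩) h1).const_mul ε
  rw [intervalIntegral.integral_eq_sub_of_hasDerivAt_of_le (f := fun s => ε * artanh (α + β * s))
    hab (fun t ht => (hder t ht).continuousAt.continuousWithinAt) ?_ hint,
    hN b (right_mem_Icc.2 hab), hN a (left_mem_Icc.2 hab)]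
  · ring
  · intro t ht
    refine (hder t (Ioo_subset_Icc_self ht)).congr_deriv ?_
    rw [tangentNorm, hd t ht, hN t (Ioo_subset_Icc_self ht)]
    ring

theorem exists_curve_len_eq (p q : disk) : ∃ γ ∈ curves p q, len γ = overlapDist p q := by
  obtain ⟨m, hpm, hqm, hov⟩ := exists_taxicab_median (p : ℝ × ℝ) q
  have hp : taxicabNorm (p : ℝ × ℝ) < 1 := p.2
  have hq : taxicabNorm (q : ℝ × ℝ) < 1 := q.2
  let γ : ℝ → ℝ × ℝ := fun t => (bentPath p.1.1 m.1 q.1.1 t, bentPath p.1.2 m.2 q.1.2 t)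
  have γl : ∀ t ≤ 1 / 2, γ t = m + (1 - 2 * t) • ((p : ℝ × ℝ) - m) := fun t ht => by
    ext <;> simp [γ, bentPath_of_le _ _ _ ht]
  have γr : ∀ t, 1 / 2 ≤ t → γ t = m + (2 * t - 1) • ((q : ℝ × ℝ) - m) := fun t ht => by
    ext <;> simp [γ, bentPath_of_ge _ _ _ ht]
  have Nl : ∀ t ∈ Icc (0 : ℝ) (1 / 2), taxicabNorm (γ t) =
      taxicabNorm m + (1 - 2 * t) * taxicabNorm ((p : ℝ × ℝ) - m) := fun t ht => by
    rw [γl t ht.2, taxicabNorm_add_smul hpm ⟨by linarith [ht.2], by linarith [ht.1]⟩]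
  have Nr : ∀ t ∈ Icc (1 / 2 : ℝ) 1, taxicabNorm (γ t) =
      taxicabNorm m + (2 * t - 1) * taxicabNorm ((q : ℝ × ℝ) - m) := fun t ht => by
    rw [γr t ht.1, taxicabNorm_add_smul hqm ⟨by linarith [ht.1], by linarith [ht.2]⟩]
  have dl : ∀ t ∈ Icc (0 : ℝ) (1 / 2), γ t ∈ disk := fun t ht => by
    change taxicabNorm (γ t) < 1
    rw [Nl t ht]
    nlinarith [ht.1, ht.2, taxicabNorm_nonneg ((p : ℝ × ℝ) - m)]
  have dr : ∀ t ∈ Icc (1 / 2 : ℝ) 1, γ t ∈ disk := fun t ht => by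
    change taxicabNorm (γ t) < 1
    rw [Nr t ht]
    nlinarith [ht.1, ht.2, taxicabNorm_nonneg ((q : ℝ × ℝ) - m)]
  have γ0 : γ 0 = p := by rw [γl 0 (by norm_num)]; module
  have γ1 : γ 1 = q := by rw [γr 1 (by norm_num)]; module
  have hm : taxicabNorm (γ (1 / 2)) = taxicabNorm m := by rw [Nr _ (by norm_num)]; ring
  have hγ : γ ∈ curves p q := by
    refine ⟨absolutelyContinuousOnInterval_bentPath _ _ _ _ _,
      absolutelyContinuousOnInterval_bentPath _ _ _ _ _, fun t ht => ?_, γ0, γ1⟩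
    rcases le_total t (1 / 2) with h | h
    · exact dl t ⟨ht.1, h⟩
    · exact dr t ⟨h, ht.2⟩
  refine ⟨γ, hγ, ?_⟩
  have hint := intervalIntegrable_tangentNorm hγ
  have il := hint.mono_set (c := 0) (d := 1 / 2) (by
    rw [uIcc_of_le (by norm_num), uIcc_of_le (by norm_num)]
    exact Icc_subset_Icc_right (by norm_num))
  have ir := hint.mono_set (c := 1 / 2) (d := 1) (by
    rw [uIcc_of_le (by norm_num), uIcc_of_le (by norm_num)]
    exact Icc_subset_Icc_left (by norm_num))
  rw [len, ← intervalIntegral.integral_add_adjacent_intervals il ir,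
    integral_tangentNorm_eq (α := taxicabNorm m + taxicabNorm ((p : ℝ × ℝ) - m))
      (β := -2 * taxicabNorm ((p : ℝ × ℝ) - m)) (ε := -1) (by norm_num) dl
      (fun t ht => by rw [Nl t ht]; ring) ?_ il,
    integral_tangentNorm_eq (α := taxicabNorm m - taxicabNorm ((q : ℝ × ℝ) - m))
      (β := 2 * taxicabNorm ((q : ℝ × ℝ) - m)) (ε := 1) (by norm_num) dr
      (fun t ht => by rw [Nr t ht]; ring) ?_ ir, γ0, γ1, hm, overlapDist, hov]
  · ring
  · intro t ht
    simp only [γ, deriv_bentPath_of_gt _ _ _ ht.1, taxicabNorm, Prod.fst_sub, Prod.snd_sub, abs_mul,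
      abs_two]
    ring
  · intro t ht
    simp only [γ, deriv_bentPath_of_lt _ _ _ ht.2, taxicabNorm, Prod.fst_sub, Prod.snd_sub, abs_mul,
      abs_neg, abs_two]
    ring

theorem diskDist_eq (p q : disk) : diskDist p q = overlapDist p q := by
  obtain ⟨γ, hγ, h⟩ := exists_curve_len_eq p q
  refine IsLeast.csInf_eq ⟨⟨γ, hγ, h⟩, ?_⟩
  rintro _ ⟨δ, hδ, rfl⟩
  exact overlapDist_le_len hδ

/-! ### Betweenness -/

theorem taxicabNorm_mem_Ioo (p : disk) : taxicabNorm p ∈ Set.Ioo (-1 : ℝ) 1 :=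
  ⟨by linarith [taxicabNorm_nonneg p], p.2⟩

theorem overlap_mem_Ioo (p q : disk) : overlap p q ∈ Set.Ioo (-1 : ℝ) 1 :=
  ⟨by linarith [overlap_nonneg p q], (overlap_le_left p q).trans_lt p.2⟩

/-- The point `z` lies between `p` and `q` in the metric of the taxicab Poincaré disk. -/
def Between (z p q : disk) : Prop := diskDist p z + diskDist z q = diskDist p q

theorem between_iff {z p q : disk} :
    Between z p q ↔ artanh (taxicabNorm z) + artanh (overlap p q) =
      artanh (overlap p z) + artanh (overlap q z) := by
  rw [Between, diskDist_eq, diskDist_eq, diskDist_eq, overlapDist, overlapDist, overlapDist,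
    overlap_comm z q]
  constructor <;> intro h <;> linarith

/-- If `z` is between `p` and `q`, then for one of them, say `p`, the point `z` lies in the taxicab
sense between the origin and `p`. -/
theorem Between.overlap_eq_or {z p q : disk} (h : Between z p q) :
    overlap p z = taxicabNorm z ∨ overlap q z = taxicabNorm z := by
  have tri := taxicabNorm_sub_le p z q
  rw [taxicabNorm_sub_comm z q] at tri
  exact eq_or_eq_of_artanh_add_eq (overlap_nonneg _ _) (overlap_nonneg _ _) (overlap_nonneg _ _)
    z.2 (overlap_le_right _ _) (overlap_le_right _ _) (overlap_mem_Ioo p q).2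
    (by unfold overlap; linarith) (between_iff.1 h)

theorem Between.overlap_eq {z p q : disk} (h : Between z p q)
    (hp : overlap p z = taxicabNorm z) (hq : overlap q z = taxicabNorm z) :
    overlap p q = taxicabNorm z := by
  have := between_iff.1 h
  rw [hp, hq] at this
  exact artanh_injOn (overlap_mem_Ioo p q) (taxicabNorm_mem_Ioo z) (by linarith)

theorem abs_add_abs_sub_of_overlap_eq {p z : ℝ × ℝ} (h : overlap p z = taxicabNorm z) :
    |z.1| + |p.1 - z.1| = |p.1| ∧ |z.2| + |p.2 - z.2| = |p.2| := by
  have h1 := abs_add_le z.1 (p.1 - z.1)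
  have h2 := abs_add_le z.2 (p.2 - z.2)
  simp only [add_sub_cancel, overlap, taxicabNorm, Prod.fst_sub, Prod.snd_sub] at h h1 h2
  constructor <;> linarith

/-- Two reals that lie beyond `z ≠ 0`, seen from the origin, and on different sides of `z`:
one of them is `z`. -/
theorem eq_or_eq_of_abs_add_abs_sub {x y z : ℝ} (hz : z ≠ 0) (hx : |z| + |x - z| = |x|)
    (hy : |z| + |y - z| = |y|) (hxy : |x - y| = |x - z| + |y - z|) : x = z ∨ y = z := by
  grind

theorem Between.coord_eq_or {z p q : disk} (h : Between z p q)
    (hp : overlap p z = taxicabNorm z) (hq : overlap q z = taxicabNorm z) :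
    (z.1.1 ≠ 0 → p.1.1 = z.1.1 ∨ q.1.1 = z.1.1) ∧ (z.1.2 ≠ 0 → p.1.2 = z.1.2 ∨ q.1.2 = z.1.2) := by
  have hpq := h.overlap_eq hp hq
  have p12 := abs_add_abs_sub_of_overlap_eq hp
  have q12 := abs_add_abs_sub_of_overlap_eq hq
  have h1 := abs_sub_le p.1.1 z.1.1 q.1.1
  have h2 := abs_sub_le p.1.2 z.1.2 q.1.2
  rw [abs_sub_comm z.1.1] at h1
  rw [abs_sub_comm z.1.2] at h2
  simp only [overlap, taxicabNorm, Prod.fst_sub, Prod.snd_sub] at hpq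
  exact ⟨fun hz => eq_or_eq_of_abs_add_abs_sub hz p12.1 q12.1 (by linarith),
    fun hz => eq_or_eq_of_abs_add_abs_sub hz p12.2 q12.2 (by linarith)⟩

/-! ### Metric characterizations of the axes and of the origin -/

/-- The point `z` is a center of four directions: there are four points different from `z` such
that `z` lies between any two of them. These are exactly the points on the coordinate axes. -/
def IsCross (z : disk) : Prop :=
  ∃ f : Fin 4 → disk, (∀ i, f i ≠ z) ∧ ∀ i j, i ≠ j → Between z (f i) (f j)

/-- The point `z` is a center of three directions that are witnessed by centers of four directions.
Only the origin has this property. -/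
def IsCenter (z : disk) : Prop :=
  ∃ f : Fin 3 → disk, (∀ i, f i ≠ z ∧ IsCross (f i)) ∧ ∀ i j, i ≠ j → Between z (f i) (f j)

theorem isometry_between {Ψ : Equiv.Perm disk} (hΨ : Ψ ∈ isometryGroup) {z p q : disk}
    (h : Between z p q) : Between (Ψ z) (Ψ p) (Ψ q) := by
  unfold Between at *
  rwa [hΨ, hΨ, hΨ]

theorem isometry_isCross {Ψ : Equiv.Perm disk} (hΨ : Ψ ∈ isometryGroup) {z : disk}
    (h : IsCross z) : IsCross (Ψ z) := by
  obtain ⟨f, h1, h2⟩ := h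
  exact ⟨fun i => Ψ (f i), fun i => Ψ.injective.ne (h1 i),
    fun i j hij => isometry_between hΨ (h2 i j hij)⟩

theorem isometry_isCenter {Ψ : Equiv.Perm disk} (hΨ : Ψ ∈ isometryGroup) {z : disk}
    (h : IsCenter z) : IsCenter (Ψ z) := by
  obtain ⟨f, h1, h2⟩ := h
  exact ⟨fun i => Ψ (f i), fun i => ⟨Ψ.injective.ne (h1 i).1, isometry_isCross hΨ (h1 i).2⟩,
    fun i j hij => isometry_between hΨ (h2 i j hij)⟩

theorem IsCross.fst_eq_zero_or_snd_eq_zero {z : disk} (h : IsCross z) :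
    z.1.1 = 0 ∨ z.1.2 = 0 := by
  by_contra! hz
  obtain ⟨f, hne, hb⟩ := h
  have hne' : ∀ i, ¬((f i).1.1 = z.1.1 ∧ (f i).1.2 = z.1.2) := fun i hi =>
    hne i (Subtype.ext (Prod.ext hi.1 hi.2))
  have hor : ∀ i j, i ≠ j → overlap (f i) z = taxicabNorm z ∨ overlap (f j) z = taxicabNorm z :=
    fun i j hij => (hb i j hij).overlap_eq_or
  -- At most one of the four points is not beyond `z`; three remain.
  obtain ⟨i, j, k, hij, hik, hjk, hi, hj, hk⟩ : ∃ i j k : Fin 4, i ≠ j ∧ i ≠ k ∧ j ≠ k ∧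
      overlap (f i) z = taxicabNorm z ∧ overlap (f j) z = taxicabNorm z ∧
      overlap (f k) z = taxicabNorm z := by
    by_cases h0 : overlap (f 0) z = taxicabNorm z
    · by_cases h1 : overlap (f 1) z = taxicabNorm z
      · rcases hor 2 3 (by decide) with h | h
        · exact ⟨0, 1, 2, by decide, by decide, by decide, h0, h1, h⟩
        · exact ⟨0, 1, 3, by decide, by decide, by decide, h0, h1, h⟩
      · exact ⟨0, 2, 3, by decide, by decide, by decide, h0,
          (hor 1 2 (by decide)).resolve_left h1, (hor 1 3 (by decide)).resolve_left h1⟩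
    · exact ⟨1, 2, 3, by decide, by decide, by decide, (hor 0 1 (by decide)).resolve_left h0,
        (hor 0 2 (by decide)).resolve_left h0, (hor 0 3 (by decide)).resolve_left h0⟩
  -- In each coordinate at most one of the three differs from `z`, so one of them equals `z`.
  have eij := (hb i j hij).coord_eq_or hi hj
  have eik := (hb i k hik).coord_eq_or hi hk
  have ejk := (hb j k hjk).coord_eq_or hj hk
  have ni := hne' i
  have nj := hne' j
  have nk := hne' k
  have a1 := eij.1 hz.1
  have a2 := eij.2 hz.2
  have b1 := eik.1 hz.1
  have b2 := eik.2 hz.2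
  have c1 := ejk.1 hz.1
  have c2 := ejk.2 hz.2
  tauto

theorem IsCenter.eq_zero {z : disk} (h : IsCenter z) : (z : ℝ × ℝ) = 0 := by
  obtain ⟨f, hne, hb⟩ := h
  have hor : ∀ i j, i ≠ j → overlap (f i) z = taxicabNorm z ∨ overlap (f j) z = taxicabNorm z :=
    fun i j hij => (hb i j hij).overlap_eq_or
  obtain ⟨i, j, hij, hi, hj⟩ : ∃ i j : Fin 3, i ≠ j ∧
      overlap (f i) z = taxicabNorm z ∧ overlap (f j) z = taxicabNorm z := by
    by_cases h0 : overlap (f 0) z = taxicabNorm z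
    · rcases hor 1 2 (by decide) with h | h
      · exact ⟨0, 1, by decide, h0, h⟩
      · exact ⟨0, 2, by decide, h0, h⟩
    · exact ⟨1, 2, by decide, (hor 0 1 (by decide)).resolve_left h0,
        (hor 0 2 (by decide)).resolve_left h0⟩
  have e := (hb i j hij).coord_eq_or hi hj
  have pi := abs_add_abs_sub_of_overlap_eq hi
  have pj := abs_add_abs_sub_of_overlap_eq hj
  have ci := (hne i).2.fst_eq_zero_or_snd_eq_zero
  have cj := (hne j).2.fst_eq_zero_or_snd_eq_zero
  have ni : ¬((f i).1.1 = z.1.1 ∧ (f i).1.2 = z.1.2) := fun hi =>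
    (hne i).1 (Subtype.ext (Prod.ext hi.1 hi.2))
  have nj : ¬((f j).1.1 = z.1.1 ∧ (f j).1.2 = z.1.2) := fun hi =>
    (hne j).1 (Subtype.ext (Prod.ext hi.1 hi.2))
  by_contra hz
  have hz' : z.1.1 ≠ 0 ∨ z.1.2 ≠ 0 := by
    by_contra! hc
    exact hz (Prod.ext hc.1 hc.2)
  generalize (f i).1.1 = a at *
  generalize (f i).1.2 = b at *
  generalize (f j).1.1 = c at *
  generalize (f j).1.2 = d at *
  clear hor hb hne
  grind

/-! ### The generating symmetries and their relations -/

theorem mem_isometryGroup_of_taxicabNorm {Ψ : Equiv.Perm disk}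
    (h : ∀ p, taxicabNorm (Ψ p) = taxicabNorm p)
    (h' : ∀ p q, taxicabNorm ((Ψ p : ℝ × ℝ) - Ψ q) = taxicabNorm ((p : ℝ × ℝ) - q)) :
    Ψ ∈ isometryGroup := by
  intro p q
  simp only [diskDist_eq, overlapDist, overlap, h, h']

theorem quarterTurn_mem : quarterTurn ∈ isometryGroup := by
  refine mem_isometryGroup_of_taxicabNorm (fun p => ?_) (fun p q => ?_)
  · simp [quarterTurn, taxicabNorm, add_comm]
  · simp only [quarterTurn, taxicabNorm, Equiv.coe_fn_mk, Prod.fst_sub, Prod.snd_sub, neg_sub_neg]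
    rw [abs_sub_comm, add_comm]

theorem reflAxis₁_mem : reflAxis₁ ∈ isometryGroup := by
  refine mem_isometryGroup_of_taxicabNorm (fun p => ?_) (fun p q => ?_)
  · simp [reflAxis₁, taxicabNorm]
  · simp only [reflAxis₁, taxicabNorm, Equiv.coe_fn_mk, Prod.fst_sub, Prod.snd_sub, neg_sub_neg]
    rw [abs_sub_comm q.1.2]

theorem quarterTurn_pow_four : quarterTurn ^ 4 = 1 := by
  ext p <;> simp [quarterTurn, pow_succ]

theorem reflAxis₁_mul_self : reflAxis₁ * reflAxis₁ = 1 := by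
  ext p <;> simp [reflAxis₁]

theorem reflAxis₁_conj_quarterTurn : reflAxis₁ * quarterTurn * reflAxis₁ = quarterTurn⁻¹ := by
  rw [eq_inv_iff_mul_eq_one]
  ext p <;> simp [reflAxis₁, quarterTurn]

theorem quarterTurn_mul_reflAxis₁ : quarterTurn * reflAxis₁ = reflDiag := by
  ext p <;> simp [reflAxis₁, quarterTurn, reflDiag]

theorem quarterTurn_sq_mul_reflAxis₁ : quarterTurn ^ 2 * reflAxis₁ = reflAxis₂ := by
  ext p <;> simp [reflAxis₁, quarterTurn, reflAxis₂, pow_succ]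

theorem quarterTurn_pow_three_mul_reflAxis₁ : quarterTurn ^ 3 * reflAxis₁ = reflAntidiag := by
  ext p <;> simp [reflAxis₁, quarterTurn, reflAntidiag, pow_succ]

/-! ### Isometries fix the origin and preserve the taxicab geometry -/

/-- The center of the disk. -/
def origin : disk := ⟨0, by simp [disk, taxicabNorm]⟩

/-- The point `(1 / 2, 0)` of the disk. -/
noncomputable def east : disk := ⟨(1 / 2, 0), by norm_num [disk, taxicabNorm]⟩

/-- The point `(0, 1 / 2)` of the disk. -/
noncomputable def north : disk := ⟨(0, 1 / 2), by norm_num [disk, taxicabNorm]⟩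

/-- The point `(-1 / 2, 0)` of the disk. -/
noncomputable def west : disk := ⟨(-1 / 2, 0), by norm_num [disk, taxicabNorm, abs_div]⟩

/-- The point `(0, -1 / 2)` of the disk. -/
noncomputable def south : disk := ⟨(0, -1 / 2), by norm_num [disk, taxicabNorm, abs_div]⟩

theorem quarterTurn_east : quarterTurn east = north := by
  ext <;> simp [quarterTurn, east, north]

theorem quarterTurn_north : quarterTurn north = west := by
  ext <;> norm_num [quarterTurn, west, north]

theorem quarterTurn_west : quarterTurn west = south := by
  ext <;> simp [quarterTurn, west, south]

theorem between_symm {z p q : disk} (h : Between z p q) : Between z q p := by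
  rw [between_iff] at *
  rw [overlap_comm q p]
  linarith

theorem isCross_east : IsCross east := by
  let a : disk := ⟨(3 / 4, 0), by norm_num [disk, taxicabNorm, abs_div]⟩
  let b : disk := ⟨(1 / 2, 1 / 4), by norm_num [disk, taxicabNorm, abs_div]⟩
  let c : disk := ⟨(1 / 2, -1 / 4), by norm_num [disk, taxicabNorm, abs_div]⟩
  have key : ∀ i j, i < j → Between east (![a, b, c, origin] i) (![a, b, c, origin] j) := by
    intro i j hij
    rw [between_iff]
    fin_cases i <;> fin_cases j <;> first
      | exact absurd hij (by decide)
      | norm_num [overlap, taxicabNorm, east, origin, a, b, c, abs_div]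
  refine ⟨![a, b, c, origin], fun i => ?_, fun i j hij => ?_⟩
  · rw [Ne, Subtype.ext_iff, Prod.ext_iff]
    fin_cases i <;> norm_num [a, b, c, origin, east]
  · rcases lt_or_gt_of_ne hij with h | h
    · exact key i j h
    · exact between_symm (key j i h)

theorem isCross_north : IsCross north :=
  quarterTurn_east ▸ isometry_isCross quarterTurn_mem isCross_east

theorem isCross_west : IsCross west :=
  quarterTurn_north ▸ isometry_isCross quarterTurn_mem isCross_north

theorem isCross_south : IsCross south :=
  quarterTurn_west ▸ isometry_isCross quarterTurn_mem isCross_west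

theorem isCenter_origin : IsCenter origin := by
  refine ⟨![east, north, west], fun i => ⟨?_, ?_⟩, fun i j hij => ?_⟩
  · rw [Ne, Subtype.ext_iff, Prod.ext_iff]
    fin_cases i <;> norm_num [origin, east, north, west]
  · fin_cases i
    exacts [isCross_east, isCross_north, isCross_west]
  · rw [between_iff]
    fin_cases i <;> fin_cases j <;> first
      | exact absurd rfl hij
      | norm_num [overlap, taxicabNorm, east, north, west, origin, abs_div]

theorem isometry_origin {Ψ : Equiv.Perm disk} (hΨ : Ψ ∈ isometryGroup) : Ψ origin = origin :=
  Subtype.ext (isometry_isCenter hΨ isCenter_origin).eq_zero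

theorem diskDist_origin (p : disk) : diskDist origin p = artanh (taxicabNorm p) := by
  have h0 : taxicabNorm (0 : ℝ × ℝ) = 0 := by simp [taxicabNorm]
  have h1 : overlap 0 (p : ℝ × ℝ) = 0 := by simp [overlap, taxicabNorm]
  simp [diskDist_eq, overlapDist, origin, h0, h1]

theorem isometry_taxicabNorm {Ψ : Equiv.Perm disk} (hΨ : Ψ ∈ isometryGroup) (p : disk) :
    taxicabNorm (Ψ p) = taxicabNorm p := by
  refine artanh_injOn (taxicabNorm_mem_Ioo _) (taxicabNorm_mem_Ioo _) ?_
  rw [← diskDist_origin, ← diskDist_origin, ← hΨ origin p, isometry_origin hΨ]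

theorem isometry_overlap {Ψ : Equiv.Perm disk} (hΨ : Ψ ∈ isometryGroup) (p q : disk) :
    overlap (Ψ p) (Ψ q) = overlap p q := by
  refine artanh_injOn (overlap_mem_Ioo _ _) (overlap_mem_Ioo _ _) ?_
  have h := hΨ p q
  rw [diskDist_eq, diskDist_eq, overlapDist, overlapDist, isometry_taxicabNorm hΨ,
    isometry_taxicabNorm hΨ] at h
  linarith

/-! ### Classification of the isometries -/

theorem IsCross.eq_of_taxicabNorm_eq_half {z : disk} (h : IsCross z)
    (hz : taxicabNorm z = 1 / 2) : z = east ∨ z = north ∨ z = west ∨ z = south := by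
  simp only [Subtype.ext_iff, Prod.ext_iff, east, north, west, south]
  have h := h.fst_eq_zero_or_snd_eq_zero
  unfold taxicabNorm at hz
  grind

/-- The quantities `|x - c| - |x|` and `|x + c| - |x|` determine `x` up to truncation to
`[-c, c]`. -/
theorem eq_or_truncated {c x y : ℝ} (hc : 0 < c) (h1 : |x - c| - |x| = |y - c| - |y|)
    (h2 : |x + c| - |x| = |y + c| - |y|) : x = y ∨ (c ≤ x ∧ c ≤ y) ∨ (x ≤ -c ∧ y ≤ -c) := by
  grind

/-- A point of the disk is determined by its norm and its overlaps with the four points `east`,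
`north`, `west`, `south`: the overlaps give both coordinates, truncated to `[-1 / 2, 1 / 2]`, and
at most one of the coordinates of a point of the disk is truncated. -/
theorem eq_of_taxicabNorm_eq_of_overlap_eq {p q : disk} (h : taxicabNorm p = taxicabNorm q)
    (he : overlap p east = overlap q east) (hn : overlap p north = overlap q north)
    (hw : overlap p west = overlap q west) (hs : overlap p south = overlap q south) : p = q := by
  have hp : taxicabNorm p < 1 := p.2
  simp only [overlap, east, north, west, south, taxicabNorm, Prod.fst_sub, Prod.snd_sub, sub_zero,
    neg_div, sub_neg_eq_add] at he hn hw hs h hp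
  have s1 := eq_or_truncated (c := 1 / 2) (x := p.1.1) (y := q.1.1) (by norm_num) (by linarith)
    (by linarith)
  have s2 := eq_or_truncated (c := 1 / 2) (x := p.1.2) (y := q.1.2) (by norm_num) (by linarith)
    (by linarith)
  clear he hn hw hs
  refine Subtype.ext ?_
  generalize (p : ℝ × ℝ) = p at *
  generalize (q : ℝ × ℝ) = q at *
  obtain ⟨a, b⟩ := p
  obtain ⟨c, d⟩ := q
  simp only at h hp s1 s2
  rw [Prod.mk.injEq]
  have a0 := abs_nonneg a
  have b0 := abs_nonneg b
  rcases s1 with s1 | ⟨s1, t1⟩ | ⟨s1, t1⟩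
  · subst s1
    refine ⟨rfl, ?_⟩
    rcases s2 with s2 | ⟨s2, t2⟩ | ⟨s2, t2⟩
    · exact s2
    · rw [abs_of_nonneg (by linarith : 0 ≤ b), abs_of_nonneg (by linarith : 0 ≤ d)] at h
      linarith
    · rw [abs_of_nonpos (by linarith : b ≤ 0), abs_of_nonpos (by linarith : d ≤ 0)] at h
      linarith
  all_goals
    obtain rfl : b = d := by
      rcases s2 with s2 | ⟨s2, t2⟩ | ⟨s2, t2⟩
      · exact s2
      all_goals linarith [le_abs_self a, neg_le_abs a, le_abs_self b, neg_le_abs b]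
    refine ⟨?_, rfl⟩
  · rw [abs_of_nonneg (by linarith : 0 ≤ a), abs_of_nonneg (by linarith : 0 ≤ c)] at h
    linarith
  · rw [abs_of_nonpos (by linarith : a ≤ 0), abs_of_nonpos (by linarith : c ≤ 0)] at h
    linarith

theorem isometry_eq_one {Ψ : Equiv.Perm disk} (hΨ : Ψ ∈ isometryGroup) (he : Ψ east = east)
    (hn : Ψ north = north) (hw : Ψ west = west) (hs : Ψ south = south) : Ψ = 1 := by
  refine Equiv.ext fun p => ?_
  refine eq_of_taxicabNorm_eq_of_overlap_eq (isometry_taxicabNorm hΨ p) ?_ ?_ ?_ ?_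
  · simpa [he] using isometry_overlap hΨ p east
  · simpa [hn] using isometry_overlap hΨ p north
  · simpa [hw] using isometry_overlap hΨ p west
  · simpa [hs] using isometry_overlap hΨ p south

/-- An isometry does not send neighbours among the four axis points to opposite points: a point that
overlaps both neighbours would go to a point that overlaps two opposite points. -/
theorem isometry_not_opposite {Ψ : Equiv.Perm disk} (hΨ : Ψ ∈ isometryGroup) :
    ¬(Ψ east = east ∧ Ψ north = west) ∧ ¬(Ψ west = south ∧ Ψ north = north) := by
  let a : disk := ⟨(1 / 4, 1 / 4), by norm_num [disk, taxicabNorm, abs_div]⟩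
  let b : disk := ⟨(-1 / 4, 1 / 4), by norm_num [disk, taxicabNorm, abs_div]⟩
  have ha1 : overlap a east = 1 / 4 := by norm_num [overlap, taxicabNorm, a, east, abs_div]
  have ha2 : overlap a north = 1 / 4 := by norm_num [overlap, taxicabNorm, a, north, abs_div]
  have hb1 : overlap b west = 1 / 4 := by norm_num [overlap, taxicabNorm, b, west, abs_div]
  have hb2 : overlap b north = 1 / 4 := by norm_num [overlap, taxicabNorm, b, north, abs_div]
  constructor
  · rintro ⟨h1, h2⟩
    have k1 := isometry_overlap hΨ a east
    have k2 := isometry_overlap hΨ a north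
    rw [h1, ha1] at k1
    rw [h2, ha2] at k2
    simp only [overlap, taxicabNorm, Prod.fst_sub, Prod.snd_sub, east, west] at k1 k2
    grind
  · rintro ⟨h1, h2⟩
    have k1 := isometry_overlap hΨ b west
    have k2 := isometry_overlap hΨ b north
    rw [h1, hb1] at k1
    rw [h2, hb2] at k2
    simp only [overlap, taxicabNorm, Prod.fst_sub, Prod.snd_sub, south, north] at k1 k2
    grind

theorem isometry_of_east_of_north {Ψ : Equiv.Perm disk} (hΨ : Ψ ∈ isometryGroup)
    (he : Ψ east = east) (hn : Ψ north = north) : Ψ = 1 := by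
  have hen : east ≠ north := by rw [Ne, Subtype.ext_iff, Prod.ext_iff]; norm_num [east, north]
  have hew : east ≠ west := by rw [Ne, Subtype.ext_iff, Prod.ext_iff]; norm_num [east, west]
  have hes : east ≠ south := by rw [Ne, Subtype.ext_iff, Prod.ext_iff]; norm_num [east, south]
  have hnw : north ≠ west := by rw [Ne, Subtype.ext_iff, Prod.ext_iff]; norm_num [north, west]
  have hns : north ≠ south := by rw [Ne, Subtype.ext_iff, Prod.ext_iff]; norm_num [north, south]
  have hws : west ≠ south := by rw [Ne, Subtype.ext_iff, Prod.ext_iff]; norm_num [west, south]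
  have iw := Ψ.injective.ne hew
  have is := Ψ.injective.ne hes
  have jw := Ψ.injective.ne hnw
  have js := Ψ.injective.ne hns
  have ws := Ψ.injective.ne hws
  have hw : Ψ west = west := by
    rcases (isometry_isCross hΨ isCross_west).eq_of_taxicabNorm_eq_half (by
      rw [isometry_taxicabNorm hΨ]; norm_num [west, taxicabNorm, abs_div]) with h | h | h | h
    · exact absurd (he.trans h.symm) iw
    · exact absurd (hn.trans h.symm) jw
    · exact h
    · exact absurd ⟨h, hn⟩ (isometry_not_opposite hΨ).2
  refine isometry_eq_one hΨ he hn hw ?_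
  rcases (isometry_isCross hΨ isCross_south).eq_of_taxicabNorm_eq_half (by
    rw [isometry_taxicabNorm hΨ]; norm_num [south, taxicabNorm, abs_div]) with h | h | h | h
  · exact absurd (he.trans h.symm) is
  · exact absurd (hn.trans h.symm) js
  · exact absurd (hw.trans h.symm) ws
  · exact h

theorem isometry_of_east {Ψ : Equiv.Perm disk} (hΨ : Ψ ∈ isometryGroup)
    (he : Ψ east = east) : Ψ = 1 ∨ Ψ = reflAxis₁ := by
  have hen : east ≠ north := by rw [Ne, Subtype.ext_iff, Prod.ext_iff]; norm_num [east, north]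
  rcases (isometry_isCross hΨ isCross_north).eq_of_taxicabNorm_eq_half (by
    rw [isometry_taxicabNorm hΨ]; norm_num [north, taxicabNorm, abs_div]) with h | h | h | h
  · exact absurd (he.trans h.symm) (Ψ.injective.ne hen)
  · exact Or.inl (isometry_of_east_of_north hΨ he h)
  · exact absurd ⟨he, h⟩ (isometry_not_opposite hΨ).1
  · right
    have h1 : reflAxis₁ * Ψ = 1 := by
      refine isometry_of_east_of_north (mul_mem reflAxis₁_mem hΨ) ?_ ?_
      · rw [Equiv.Perm.mul_apply, he]
        ext <;> simp [reflAxis₁, east]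
      · rw [Equiv.Perm.mul_apply, h]
        ext <;> norm_num [reflAxis₁, south, north]
    rw [eq_comm, ← mul_right_inj reflAxis₁, h1, reflAxis₁_mul_self]

theorem isometry_classification {Ψ : Equiv.Perm disk} (hΨ : Ψ ∈ isometryGroup) :
    ∃ k : ℕ, Ψ = quarterTurn ^ k ∨ Ψ = quarterTurn ^ k * reflAxis₁ := by
  obtain ⟨k, hk⟩ : ∃ k : ℕ, (quarterTurn ^ k) east = Ψ east := by
    rcases (isometry_isCross hΨ isCross_east).eq_of_taxicabNorm_eq_half (by
      rw [isometry_taxicabNorm hΨ]; norm_num [east, taxicabNorm, abs_div]) with h | h | h | h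
    · exact ⟨0, by simp [h]⟩
    · exact ⟨1, by simp [h, quarterTurn_east]⟩
    · exact ⟨2, by simp [h, pow_succ, quarterTurn_east, quarterTurn_north]⟩
    · exact ⟨3, by simp [h, pow_succ, quarterTurn_east, quarterTurn_north, quarterTurn_west]⟩
  refine ⟨k, ?_⟩
  have h := isometry_of_east (Ψ := (quarterTurn ^ k)⁻¹ * Ψ)
    (mul_mem (inv_mem (pow_mem quarterTurn_mem k)) hΨ)
    (by rw [Equiv.Perm.mul_apply, Equiv.Perm.inv_eq_iff_eq, hk])
  rwa [inv_mul_eq_one, inv_mul_eq_iff_eq_mul, eq_comm] at h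

theorem mem_isometryGroup_iff (Ψ : Equiv.Perm disk) :
    Ψ ∈ isometryGroup ↔ (∃ k : ℤ, Ψ = quarterTurn ^ k) ∨
      Ψ = reflAxis₁ ∨ Ψ = reflAxis₂ ∨ Ψ = reflDiag ∨ Ψ = reflAntidiag := by
  constructor
  · intro hΨ
    obtain ⟨k, h | h⟩ := isometry_classification hΨ
    · exact Or.inl ⟨k, by rw [h, zpow_natCast]⟩
    · rw [pow_eq_pow_mod k quarterTurn_pow_four] at h
      have hk : k % 4 < 4 := Nat.mod_lt _ (by norm_num)
      right
      generalize k % 4 = j at h hk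
      interval_cases j
      · simp [h]
      · simp [h, quarterTurn_mul_reflAxis₁]
      · simp [h, quarterTurn_sq_mul_reflAxis₁]
      · simp [h, quarterTurn_pow_three_mul_reflAxis₁]
  · rintro (⟨k, rfl⟩ | rfl | rfl | rfl | rfl)
    · exact zpow_mem quarterTurn_mem k
    · exact reflAxis₁_mem
    · exact quarterTurn_sq_mul_reflAxis₁ ▸ mul_mem (pow_mem quarterTurn_mem 2) reflAxis₁_mem
    · exact quarterTurn_mul_reflAxis₁ ▸ mul_mem quarterTurn_mem reflAxis₁_mem
    · exact quarterTurn_pow_three_mul_reflAxis₁ ▸ mul_mem (pow_mem quarterTurn_mem 3) reflAxis₁_mem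

/-! ### The dihedral group -/

/-- The rotation part of `dihedralHom`: the homomorphism from `ZMod n` that sends `1` to `r`. -/
def rotationHom {G : Type*} [Group G] {n : ℕ} (r : G) (hr : r ^ n = 1) :
    ZMod n →+ Additive G :=
  ZMod.lift n ⟨zmultiplesHom (Additive G) (Additive.ofMul r), by
    rw [zmultiplesHom_apply, natCast_zsmul, ← ofMul_pow, hr, ofMul_one]⟩

theorem rotationHom_intCast {G : Type*} [Group G] {n : ℕ} (r : G) (hr : r ^ n = 1) (k : ℤ) :
    (rotationHom r hr (k : ZMod n)).toMul = r ^ k := by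
  simp [rotationHom]

/-- The homomorphism out of a dihedral group given by elements `r` and `s` subject to the relations
`r ^ n = 1`, `s * s = 1` and `s * r * s = r⁻¹`. It sends `DihedralGroup.sr i` to `s * r ^ i`. -/
def dihedralHom {G : Type*} [Group G] {n : ℕ} (r s : G) (hr : r ^ n = 1) (hs : s * s = 1)
    (hrs : s * r * s = r⁻¹) : DihedralGroup n →* G :=
  MonoidHom.mk' (fun x => match x with
    | .r i => (rotationHom r hr i).toMul
    | .sr i => s * (rotationHom r hr i).toMul) (by
    have comm : ∀ i : ZMod n, (rotationHom r hr i).toMul * s =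
        s * ((rotationHom r hr i).toMul)⁻¹ := by
      intro i
      obtain ⟨k, rfl⟩ := ZMod.intCast_surjective i
      have hs' : s⁻¹ = s := inv_eq_of_mul_eq_one_left hs
      have h := conj_zpow (a := s) (b := r) (i := k)
      rw [hs', hrs] at h
      rw [rotationHom_intCast, ← inv_zpow, h, ← mul_assoc, ← mul_assoc, hs, one_mul]
    rintro (i | i) (j | j)
    · simp
    · simp only [DihedralGroup.r_mul_sr, sub_eq_neg_add, map_add, map_neg, toMul_add, toMul_neg]
      rw [← mul_assoc, ← mul_assoc, comm]
    · simp [mul_assoc]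
    · simp only [DihedralGroup.sr_mul_sr, sub_eq_neg_add, map_add, map_neg, toMul_add, toMul_neg]
      rw [mul_assoc, ← mul_assoc _ s, comm, ← mul_assoc, ← mul_assoc, hs, one_mul])

/-- The action of the dihedral group of order `8` on the disk: `r 1` acts as the quarter turn, `sr 0`
as the reflection in the first axis. -/
def diskDihedralHom : DihedralGroup 4 →* Equiv.Perm disk :=
  dihedralHom quarterTurn reflAxis₁ quarterTurn_pow_four reflAxis₁_mul_self
    reflAxis₁_conj_quarterTurn

theorem diskDihedralHom_r (k : ℤ) : diskDihedralHom (.r k) = quarterTurn ^ k :=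
  rotationHom_intCast _ _ k

theorem diskDihedralHom_sr (k : ℤ) : diskDihedralHom (.sr k) = reflAxis₁ * quarterTurn ^ k :=
  congrArg (reflAxis₁ * ·) (rotationHom_intCast _ quarterTurn_pow_four k)

theorem diskDihedralHom_injective : Function.Injective diskDihedralHom := by
  rw [injective_iff_map_eq_one]
  -- The point `(1 / 2, 1 / 4)` has trivial stabilizer.
  let a : disk := ⟨(1 / 2, 1 / 4), by norm_num [disk, taxicabNorm, abs_div]⟩
  have cast (i : ZMod 4) : ((i.val : ℤ) : ZMod 4) = i := by simp
  rintro (i | i) h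
  · rw [← cast i, diskDihedralHom_r, zpow_natCast] at h
    have ha := congrArg Subtype.val (Equiv.congr_fun h a)
    have hi := i.val_lt
    have hval : i.val = 0 := by
      generalize i.val = k at ha hi
      rw [Prod.ext_iff] at ha
      interval_cases k
      · rfl
      all_goals norm_num [quarterTurn, a, pow_succ] at ha
    rw [(ZMod.val_eq_zero i).1 hval, DihedralGroup.r_zero]
  · rw [← cast i, diskDihedralHom_sr, zpow_natCast] at h
    have ha := congrArg Subtype.val (Equiv.congr_fun h a)
    have hi := i.val_lt
    generalize i.val = k at ha hi
    rw [Prod.ext_iff] at ha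
    interval_cases k <;> norm_num [quarterTurn, reflAxis₁, a, pow_succ] at ha

theorem range_diskDihedralHom : diskDihedralHom.range = isometryGroup := by
  apply le_antisymm
  · rintro _ ⟨x | x, rfl⟩ <;> obtain ⟨k, rfl⟩ := ZMod.intCast_surjective x
    · rw [diskDihedralHom_r]
      exact zpow_mem quarterTurn_mem k
    · rw [diskDihedralHom_sr]
      exact mul_mem reflAxis₁_mem (zpow_mem quarterTurn_mem k)
  · have hr : quarterTurn ∈ diskDihedralHom.range :=
      ⟨.r (1 : ℤ), by rw [diskDihedralHom_r, zpow_one]⟩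
    have hs : reflAxis₁ ∈ diskDihedralHom.range :=
      ⟨.sr (0 : ℤ), by rw [diskDihedralHom_sr, zpow_zero, mul_one]⟩
    intro Ψ hΨ
    obtain ⟨k, rfl | rfl⟩ := isometry_classification hΨ
    · exact pow_mem hr k
    · exact mul_mem (pow_mem hr k) hs

end TaxicabPoincare

theorem theoremC :
    Nonempty (TaxicabPoincare.isometryGroup ≃* DihedralGroup 4) ∧
    ∀ Ψ : Equiv.Perm TaxicabPoincare.disk,
      Ψ ∈ TaxicabPoincare.isometryGroup ↔
        (∃ k : ℤ, Ψ = TaxicabPoincare.quarterTurn ^ k) ∨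
        Ψ = TaxicabPoincare.reflAxis₁ ∨ Ψ = TaxicabPoincare.reflAxis₂ ∨
        Ψ = TaxicabPoincare.reflDiag ∨ Ψ = TaxicabPoincare.reflAntidiag := by
  refine ⟨⟨?_⟩, TaxicabPoincare.mem_isometryGroup_iff⟩
  exact ((MonoidHom.ofInjective TaxicabPoincare.diskDihedralHom_injective).trans
    (MulEquiv.subgroupCongr TaxicabPoincare.range_diskDihedralHom)).symm
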